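/- Let $(k_n)_{n=1}^\infty$ be a sequence of real numbers with $k_n\ge 2$ for all $n$ and $\limsup_{n\to\infty}k_n=\infty$, and let $0<s\le t\le 1$. Then there are finite index sets $\mathcal J_n$ with $\#\mathcal J_n\ge 2$ and similarity maps $S_{n,j}(x)=\pm r_{n,j}x+d_{n,j}$ of $\mathbb R$ $(n\in\mathbb N,\ j\in\mathcal J_n)$, with $r_{n,j}\in(0,1)$, $S_{n,j}([0,1])\subset[0,1]$, and $\lim_{n\to\infty}\sup\{r_{1,j_1}\cdots r_{n,j_n}: j_i\in\mathcal J_i\}=0$ (that is, a non-autonomous iterated function system on the invariant compact set $X=[0,1]$), with limit set $$K=\bigcap_{n=1}^\infty\ \bigcup_{(j_1,\dots,j_n)\in\mathcal J_1\times\cdots\times\mathcal J_n}S_{1,j_1}\circ\cdots\circ S_{n,j_n}([0,1]),$$ such that: 1. the system is homogeneous: for each $n$ there is $r_n$ with $r_{n,j}=r_n$ for all $j\in\mathcal J_n$; 2. the open set condition holds with respect to the interior $(0,1)$ of $X$: $S_{n,j}((0,1))\cap S_{n,j'}((0,1))=\varnothing$ for all $n$ and all $j\ne j'$ in $\mathcal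 J_n$; moreover the cone condition $\inf_{x\in X}\inf_{0<r<1}r^{-1}\mathcal L^1(B(x,r)\cap(0,1))>0$ holds, where $\mathcal L^1$ is Lebesgue measure; 3. $\#\mathcal J_n\le k_n$ for all $n\in\mathbb N$; 4. $\dim_{\mathrm A}K=t$, where $\dim_{\mathrm A}K$ is the infimum of all real $\alpha$ for which there is $C>0$ such that, for all $0<r\le R<1$ and $x\in K$, the set $B(x,R)\cap K$ can be covered by at most $C(R/r)^\alpha$ closed balls of radius $r$; 5. $\theta(n,m)=s$ for all $n,m\in\mathbb N$ (where $n,m\ge1$), where $\theta(n,m)$ is the unique real zero of the pressure $$\phi_{n,m}(u)=\frac1m\log\sum_{j_0\in\mathcal J_n}\cdots\sum_{j_{m-1}\in\mathcal J_{n+m-1}}\ \prod_{i=0}^{m-1}r_{n+i,j_i}^{\,u}.$$ -/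

import Mathlib

open Set Filter Topology MeasureTheory
open scoped NNReal ENNReal

/-- A non-autonomous self-similar iterated function system on a Euclidean space `E`.
The levels are indexed by `n = 0, 1, 2, …`. At level `n` there are the similarities
`x ↦ ratio n j • orth n j x + trans n j`, with `j` in the finite index set `J n`. -/
structure NonautonomousIFS (E : Type*) [NormedAddCommGroup E] [InnerProductSpace ℝ E] where
  J : ℕ → Type
  [fintypeJ : ∀ n, Fintype (J n)]
  two_le_card : ∀ n, 2 ≤ Fintype.card (J n)
  ratio : ∀ n, J n → ℝ
  ratio_pos : ∀ n j, 0 < ratio n j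
  ratio_lt_one : ∀ n j, ratio n j < 1
  /-- the orthogonal parts -/
  orth : ∀ n, J n → (E ≃ₗᵢ[ℝ] E)
  /-- the translation parts -/
  trans : ∀ n, J n → E
  /-- the associated invariant compact set -/
  X : Set E
  isCompact_X : IsCompact X
  nonempty_X : X.Nonempty
  mapsTo_X : ∀ n j, MapsTo (fun x : E => ratio n j • orth n j x + trans n j) X X
  tendsto_ratio : Tendsto
    (fun n : ℕ => ⨆ j : (∀ i : Fin n, J i), ∏ i : Fin n, ratio i (j i)) atTop (𝓝 0)

namespace NonautonomousIFS

variable {E : Type*} [NormedAddCommGroup E] [InnerProductSpace ℝ E]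

instance (Φ : NonautonomousIFS E) (n : ℕ) : Fintype (Φ.J n) := Φ.fintypeJ n

/-- The similarity `S_{n,j}`. -/
def S (Φ : NonautonomousIFS E) (n : ℕ) (j : Φ.J n) (x : E) : E :=
  Φ.ratio n j • Φ.orth n j x + Φ.trans n j

/-- The composition `S_{0,j₀} ∘ ⋯ ∘ S_{n-1,j_{n-1}}` of the maps of the first `n` levels. -/
def comp (Φ : NonautonomousIFS E) : (n : ℕ) → (∀ i : Fin n, Φ.J i) → E → E
  | 0, _ => id
  | n + 1, j => comp Φ n (fun i => j i.castSucc) ∘ Φ.S n (j (Fin.last n))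

/-- The limit set `K`: the intersection over `n ≥ 1` of the unions of the images of `X` under
all compositions of maps of the first `n` levels. -/
def limitSet (Φ : NonautonomousIFS E) : Set E :=
  ⋂ n : ℕ, ⋃ j : (∀ i : Fin (n + 1), Φ.J i), Φ.comp (n + 1) j '' Φ.X

/-- Homogeneity: within each level all contraction ratios agree. -/
def IsHomogeneous (Φ : NonautonomousIFS E) : Prop :=
  ∀ n, ∃ ρ : ℝ, ∀ j : Φ.J n, Φ.ratio n j = ρ

/-- The pressure `φ_{n,m}(t)`, built from the `m` levels `n, …, n + m - 1`, for `m ≥ 1`. -/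
noncomputable def pressure (Φ : NonautonomousIFS E) (n m : ℕ) (t : ℝ) : ℝ :=
  (1 / (m : ℝ)) *
    Real.log (∑ j : (∀ k : Fin m, Φ.J (n + k)), ∏ k : Fin m, Φ.ratio (n + k) (j k) ^ t)

/-- `θ(n,m) = θ`: the number `θ` is the unique real zero of the pressure `φ_{n,m}`. -/
def IsTheta (Φ : NonautonomousIFS E) (n m : ℕ) (θ : ℝ) : Prop :=
  ∀ t : ℝ, Φ.pressure n m t = 0 ↔ t = θ

/-- The open set condition, realised by the compact set `Y`: `Y` is invariant, its interior is
non-empty, and distinct maps of the same level send this interior to disjoint sets. (The open set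
condition asks for some such `Y`.) -/
def OpenSetConditionWith (Φ : NonautonomousIFS E) (Y : Set E) : Prop :=
  IsCompact Y ∧ (∀ n (j : Φ.J n), Φ.S n j '' Y ⊆ Y) ∧ (interior Y).Nonempty ∧
    ∀ n (j j' : Φ.J n), j ≠ j' → Disjoint (Φ.S n j '' interior Y) (Φ.S n j' '' interior Y)

end NonautonomousIFS

/-- The cone condition for a subset `X` of a `d`-dimensional Euclidean space with its Lebesgue
measure: `r⁻ᵈ` times the measure of `B(x,r) ∩ interior X` has a positive lower bound over all
`x ∈ X` and `0 < r < 1`. -/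
def ConeCondition {E : Type*} [NormedAddCommGroup E] [InnerProductSpace ℝ E] [MeasureSpace E]
    (X : Set E) : Prop :=
  ∃ c : ℝ, 0 < c ∧ ∀ x ∈ X, ∀ r : ℝ, 0 < r → r < 1 →
    ENNReal.ofReal (c * r ^ Module.finrank ℝ E) ≤ volume (Metric.closedBall x r ∩ interior X)

/-- `s` is an admissible exponent in the definition of the Assouad dimension of `K`: for some `C`,
`N_r(B(x,R) ∩ K) ≤ C (R/r)^s` whenever `0 < r ≤ R < 1` and `x ∈ K`, where `N_r` is the least number
of closed balls of radius `r` (with arbitrary centres) that cover. -/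
def IsAssouadExponent {E : Type*} [PseudoMetricSpace E] (K : Set E) (s : ℝ) : Prop :=
  ∃ C : ℝ, 0 < C ∧ ∀ r R : ℝ≥0, 0 < r → r ≤ R → R < 1 → ∀ x ∈ K,
    ((Metric.externalCoveringNumber r (Metric.closedBall x R ∩ K) : ℕ∞) : ℝ≥0∞)
      ≤ ENNReal.ofReal (C * ((R : ℝ) / (r : ℝ)) ^ s)

/-- The Assouad dimension, as an infimum in the extended reals. -/
noncomputable def assouadDim {E : Type*} [PseudoMetricSpace E] (K : Set E) : EReal :=
  ⨅ (s : ℝ) (_ : IsAssouadExponent K s), (s : EReal)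

/-!
The system is built so that its limit set is a set of binary digit sums
`∑ q, (1 - a) * u q * ε q` with `ε q ∈ {0, 1}`. Put `a = 2 ^ (-1/t)` and `a * c = 2 ^ (-1/s)`, so
that `a ≤ 1/2` and `c ≤ 1`. Level `n` has `2 ^ p n` maps of ratio `(a * c) ^ p n`, where `p n` is the
integer part of the binary logarithm of `k n`. As the number of maps of a level times the `s`-th
power of its ratio is `1`, all pressures vanish exactly at `s`, whatever the translations are
(`isTheta_clusterSystem`). The translations are chosen so that the intervals of a level form the
`p n`-th stage of the central Cantor construction with ratio `a`, a set of dimension `t`, shrunk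
towards `0` by the factor `c ^ p n` (`clusterSystem`).

Reading a map of level `n` as a block of `p n` binary digits gives cylinders of every binary length
`q`, with diameters at most `u q` (`scale`). Within a block `u (q + 1) = a * u q`, and the step to the
next block only shrinks further, so `u (q + 1) ≤ a * u q` always. Since `a ≤ 1/2`, cylinders of
the same length do not overlap (`le_abs_digitSum_sub`). A ball of radius `R` therefore meets boundedly
many cylinders of diameter about `R`, and each of them splits into at most a constant times
`(R / r) ^ t` cylinders of diameter about `r`: the Assouad dimension is at most `t`
(`isAssouadExponent_of_cylinders`). It is at least `t` because the `p n` are unbounded, so that the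
limit set contains scaled copies of arbitrarily late stages of the Cantor construction of ratio `a`
(`le_of_isAssouadExponent`).
-/


/-! ### Binary digit sums -/

/-- The sum of the weights `w i`, `i < l`, over those `i` at which the binary digit `e i` is `1`
(encoded as `true`). -/
noncomputable def digitSum (w : ℕ → ℝ) (e : ℕ → Bool) (l : ℕ) : ℝ :=
  ∑ i ∈ Finset.range l, if e i then w i else 0

/-- A finite digit string, continued by zeros. -/
def extendDigits {l : ℕ} (e : Fin l → Bool) (i : ℕ) : Bool :=
  if h : i < l then e ⟨i, h⟩ else false

/-- The set of all digit sums of length `l`. -/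
noncomputable def digitSums (w : ℕ → ℝ) (l : ℕ) : Finset ℝ :=
  Finset.univ.image fun e : Fin l → Bool => digitSum w (extendDigits e) l

theorem digitSum_succ (w : ℕ → ℝ) (e : ℕ → Bool) (l : ℕ) :
    digitSum w e (l + 1) = digitSum w e l + if e l then w l else 0 :=
  Finset.sum_range_succ _ _

theorem digitSum_add (w : ℕ → ℝ) (e : ℕ → Bool) (l m : ℕ) :
    digitSum w e (l + m) =
      digitSum w e l + digitSum (fun i => w (l + i)) (fun i => e (l + i)) m :=
  Finset.sum_range_add _ _ _

theorem digitSum_congr {w w' : ℕ → ℝ} {e e' : ℕ → Bool} {l : ℕ} (hw : ∀ i < l, w i = w' i)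
    (he : ∀ i < l, e i = e' i) : digitSum w e l = digitSum w' e' l := by
  refine Finset.sum_congr rfl fun i hi => ?_
  rw [hw i (Finset.mem_range.1 hi), he i (Finset.mem_range.1 hi)]

theorem digitSum_const_mul (w : ℕ → ℝ) (c : ℝ) (e : ℕ → Bool) (l : ℕ) :
    digitSum (fun i => c * w i) e l = c * digitSum w e l := by
  simp [digitSum, Finset.mul_sum]

theorem digitSum_nonneg {w : ℕ → ℝ} (hw : ∀ i, 0 ≤ w i) (e : ℕ → Bool) (l : ℕ) :
    0 ≤ digitSum w e l :=
  Finset.sum_nonneg fun i _ => by split_ifs <;> simp [hw i]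

theorem extendDigits_of_lt {l : ℕ} (e : Fin l → Bool) {i : ℕ} (h : i < l) :
    extendDigits e i = e ⟨i, h⟩ := dif_pos h

theorem digitSum_mem_digitSums (w : ℕ → ℝ) (e : ℕ → Bool) (l : ℕ) :
    digitSum w e l ∈ digitSums w l :=
  Finset.mem_image.2 ⟨fun i => e i, Finset.mem_univ _,
    digitSum_congr (fun _ _ => rfl) fun _ hi => extendDigits_of_lt _ hi⟩

theorem card_digitSums_le (w : ℕ → ℝ) (l : ℕ) : (digitSums w l).card ≤ 2 ^ l :=
  Finset.card_image_le.trans (by simp)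

/-- If every weight is at most half of its predecessor, then digit sums of length `l + 1` with
different digits are at least the last weight apart. -/
theorem le_abs_digitSum_sub {w : ℕ → ℝ} (hw : ∀ i, 0 < w i) (hw2 : ∀ i, w (i + 1) ≤ w i / 2)
    (e e' : ℕ → Bool) (l : ℕ) (h : ∃ i ≤ l, e i ≠ e' i) :
    w l ≤ |digitSum w e (l + 1) - digitSum w e' (l + 1)| := by
  induction l with
  | zero =>
    obtain ⟨i, hi, hne⟩ := h
    obtain rfl : i = 0 := by omega
    rw [digitSum_succ, digitSum_succ]
    have h0 := hw 0
    cases h1 : e 0 <;> cases h2 : e' 0 <;> simp_all [digitSum, abs_of_pos]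
  | succ l ih =>
    rw [digitSum_succ w e, digitSum_succ w e']
    have h0 := hw (l + 1)
    have h2 := hw2 l
    by_cases hl : ∃ i ≤ l, e i ≠ e' i
    · have := ih hl
      rw [le_abs'] at this ⊢
      rcases this with this | this <;> [left; right] <;> split_ifs <;> linarith
    · push Not at hl
      obtain ⟨i, hi, hne⟩ := h
      obtain rfl : i = l + 1 := by
        by_contra hil
        exact hne (hl i (by omega))
      rw [digitSum_congr (e' := e') (fun _ _ => rfl) fun i hi => hl i (by omega)]
      cases h1 : e (l + 1) <;> cases h2 : e' (l + 1) <;> simp_all [abs_of_pos]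

theorem le_abs_sub_of_mem_digitSums {w : ℕ → ℝ} (hw : ∀ i, 0 < w i)
    (hw2 : ∀ i, w (i + 1) ≤ w i / 2) {l : ℕ} {x y : ℝ} (hx : x ∈ digitSums w (l + 1))
    (hy : y ∈ digitSums w (l + 1)) (hxy : x ≠ y) : w l ≤ |x - y| := by
  obtain ⟨e, -, rfl⟩ := Finset.mem_image.1 hx
  obtain ⟨e', -, rfl⟩ := Finset.mem_image.1 hy
  refine le_abs_digitSum_sub hw hw2 _ _ l ?_
  by_contra! h
  exact hxy (digitSum_congr (fun _ _ => rfl) fun i hi => h i (by omega))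

theorem card_digitSums {w : ℕ → ℝ} (hw : ∀ i, 0 < w i) (hw2 : ∀ i, w (i + 1) ≤ w i / 2) (l : ℕ) :
    (digitSums w (l + 1)).card = 2 ^ (l + 1) := by
  rw [digitSums, Finset.card_image_of_injective]
  · simp
  intro e e' hee
  by_contra hne
  obtain ⟨i, hi⟩ := Function.ne_iff.1 hne
  have := le_abs_digitSum_sub hw hw2 (extendDigits e) (extendDigits e') l
    ⟨i, by omega, by rwa [extendDigits_of_lt _ i.2, extendDigits_of_lt _ i.2]⟩
  simp only at hee
  rw [hee, sub_self, abs_zero] at this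
  exact (hw l).not_ge this

/-! ### Cylinder scales

A sequence `u` with `u (i + 1) ≤ a * u i` bounds the diameters of the binary cylinders, the weights
being `(1 - a) * u i`. -/

/-- The weights telescope: `(1 - a) * u i ≤ u i - u (i + 1)`. -/
theorem digitSum_scale_le {a : ℝ} {u : ℕ → ℝ} (ha1 : a ≤ 1) (hu : ∀ i, 0 < u i)
    (hua : ∀ i, u (i + 1) ≤ a * u i) (e : ℕ → Bool) (q m : ℕ) :
    digitSum (fun i => (1 - a) * u (q + i)) e m ≤ u q - u (q + m) := by
  induction m with
  | zero => simp [digitSum]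
  | succ m ih =>
    rw [digitSum_succ, ← add_assoc]
    have h1 := hua (q + m)
    have h2 : 0 ≤ (1 - a) * u (q + m) := mul_nonneg (by linarith) (hu _).le
    split_ifs <;> linarith

theorem scale_add_le {a : ℝ} {u : ℕ → ℝ} (ha : 0 < a) (hua : ∀ i, u (i + 1) ≤ a * u i) (q m : ℕ) :
    u (q + m) ≤ a ^ m * u q := by
  induction m with
  | zero => simp
  | succ m ih =>
    calc u (q + m + 1) ≤ a * u (q + m) := hua _
      _ ≤ a * (a ^ m * u q) := by gcongr
      _ = a ^ (m + 1) * u q := by ring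

theorem exists_scale_le {a : ℝ} {u : ℕ → ℝ} (ha : 0 < a) (ha1 : a < 1)
    (hua : ∀ i, u (i + 1) ≤ a * u i) {r : ℝ} (hr : 0 < r) : ∃ q, u q ≤ r := by
  have h : Tendsto (fun q : ℕ => a ^ q * u 0) atTop (𝓝 0) := by
    simpa using (tendsto_pow_atTop_nhds_zero_of_lt_one ha.le ha1).mul_const (u 0)
  obtain ⟨q, hq⟩ := (h.eventually_lt_const hr).exists
  exact ⟨q, by simpa using (scale_add_le ha hua 0 q).trans hq.le⟩

/-! ### Bounds for the Assouad dimension -/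

/-- A set of reals with mutual distances at least `δ` has at most `N` points in an interval of
length less than `N * δ`. -/
theorem card_le_of_separated {A : Finset ℝ} {δ z : ℝ} {N : ℕ} (hδ : 0 < δ)
    (hsep : ∀ x ∈ A, ∀ y ∈ A, x ≠ y → δ ≤ |x - y|) (hA : ∀ x ∈ A, z ≤ x ∧ x < z + N * δ) :
    A.card ≤ N := by
  rw [← Finset.card_range N]
  refine Finset.card_le_card_of_injOn (fun x => ⌊(x - z) / δ⌋₊) ?_ ?_
  · intro x hx
    obtain ⟨h1, h2⟩ := hA x hx
    have : ⌊(x - z) / δ⌋₊ < N := by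
      rw [Nat.floor_lt (div_nonneg (by linarith) hδ.le), div_lt_iff₀ hδ]
      linarith
    simpa using this
  · intro x hx y hy hxy
    by_contra hne
    have h1 := hsep x hx y hy hne
    have hx0 : 0 ≤ (x - z) / δ := div_nonneg (by linarith [(hA x hx).1]) hδ.le
    have hy0 : 0 ≤ (y - z) / δ := div_nonneg (by linarith [(hA y hy).1]) hδ.le
    have h2 := Nat.floor_le hx0
    have h3 := Nat.lt_floor_add_one ((x - z) / δ)
    have h4 := Nat.floor_le hy0
    have h5 := Nat.lt_floor_add_one ((y - z) / δ)
    simp only at hxy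
    rw [hxy] at h2 h3
    have h6 : |(x - z) / δ - (y - z) / δ| < 1 := by rw [abs_lt]; constructor <;> linarith
    have h7 : (x - z) / δ - (y - z) / δ = (x - y) / δ := by ring
    rw [h7, abs_div, abs_of_pos hδ, div_lt_one hδ] at h6
    linarith

/-- The upper bound for the Assouad dimension. A ball of radius `R` meets at most six cylinders of
the first length `q` with `u q ≤ R`, and each of them has `2 ^ (q' - q)` subcylinders of the first
length `q'` with `u q' ≤ r`. -/
theorem isAssouadExponent_of_cylinders {a t : ℝ} {u : ℕ → ℝ} {K : Set ℝ} (ha : 0 < a)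
    (ha2 : a ≤ 1 / 2) (ht : 0 < t) (hat : (a⁻¹) ^ t = 2) (hu : ∀ i, 0 < u i)
    (hua : ∀ i, u (i + 1) ≤ a * u i)
    (hK : ∀ q, ∀ y ∈ K, ∃ e, digitSum (fun i => (1 - a) * u i) e q ≤ y ∧
      y ≤ digitSum (fun i => (1 - a) * u i) e q + u q) :
    IsAssouadExponent K t := by
  classical
  refine ⟨12, by norm_num, fun r R hr hrR _ x _ => ?_⟩
  have hr' : (0 : ℝ) < r := hr
  have hrR' : (r : ℝ) ≤ R := hrR
  have hR' : (0 : ℝ) < R := hr'.trans_le hrR'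
  set w : ℕ → ℝ := fun i => (1 - a) * u i with hw_def
  have hw : ∀ i, 0 < w i := fun i => mul_pos (by linarith) (hu i)
  have hw2 : ∀ i, w (i + 1) ≤ w i / 2 := fun i => by
    have h1 := hua i
    have h2 := mul_le_mul_of_nonneg_right ha2 (hu i).le
    have h3 := mul_le_mul_of_nonneg_left (h1.trans h2) (by linarith : 0 ≤ 1 - a)
    simp only [hw_def]; linarith
  have hexR := exists_scale_le ha (by linarith) hua hR'
  have hexr := exists_scale_le ha (by linarith) hua hr'
  set q := Nat.find hexR with hq
  set q' := Nat.find hexr with hq'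
  have huq : u q ≤ R := Nat.find_spec hexR
  have huq' : u q' ≤ r := Nat.find_spec hexr
  have hqq : q ≤ q' := Nat.find_min' _ (huq'.trans hrR')
  obtain ⟨m, hm⟩ := Nat.exists_eq_add_of_le hqq
  -- the left endpoints of the cylinders of length `q` near `x`
  set A : Finset ℝ := (digitSums w q).filter fun z => x - 2 * R ≤ z ∧ z ≤ x + R with hA
  set B : Finset ℝ := digitSums (fun i => w (q + i)) m with hB
  have hAcard : A.card ≤ 6 := by
    rcases Nat.eq_zero_or_pos q with h0 | h0
    · calc A.card ≤ (digitSums w q).card := Finset.card_filter_le _ _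
        _ ≤ 2 ^ q := card_digitSums_le _ _
        _ ≤ 6 := by rw [h0]; norm_num
    · obtain ⟨l, hl⟩ := Nat.exists_eq_succ_of_ne_zero h0.ne'
      have hRu : (R : ℝ) < u l := not_le.1 (Nat.find_min hexR (by omega))
      have hwl : u l / 2 ≤ w l := by
        have := mul_le_mul_of_nonneg_right ha2 (hu l).le
        simp only [hw_def]; linarith
      refine card_le_of_separated (hw l) (z := x - 2 * R) ?_ ?_
      · intro y hy z hz hyz
        rw [hA, hl, Finset.mem_filter] at hy hz
        exact le_abs_sub_of_mem_digitSums hw hw2 hy.1 hz.1 hyz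
      · intro y hy
        obtain ⟨-, h1, h2⟩ := Finset.mem_filter.1 hy
        refine ⟨h1, ?_⟩
        push_cast
        linarith
  have hpow : (2 : ℝ) ^ m ≤ 2 * ((R : ℝ) / r) ^ t := by
    have hRr : 1 ≤ (R : ℝ) / r := (one_le_div hr').2 hrR'
    rcases m with _ | m
    · have := Real.one_le_rpow hRr ht.le
      rw [pow_zero]; linarith
    · have h1 : (r : ℝ) < u (q + m) := not_le.1 (Nat.find_min hexr (by omega))
      have h2 : (r : ℝ) ≤ a ^ m * R :=
        h1.le.trans ((scale_add_le ha hua q m).trans (by gcongr))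
      have h3 : (a⁻¹) ^ m ≤ (R : ℝ) / r := by
        rw [le_div_iff₀ hr', inv_pow, inv_mul_le_iff₀ (by positivity)]
        exact h2
      have h4 : (2 : ℝ) ^ m = ((a⁻¹) ^ m) ^ t := by
        rw [← hat, ← Real.rpow_natCast, ← Real.rpow_natCast, ← Real.rpow_mul (by positivity),
          ← Real.rpow_mul (by positivity), mul_comm]
      rw [pow_succ, h4, mul_comm]
      gcongr
  have hcover : Metric.IsCover r (Metric.closedBall x R ∩ K)
      ((Finset.image₂ (· + ·) A B : Finset ℝ) : Set ℝ) := by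
    rintro y ⟨hyx, hyK⟩
    obtain ⟨e, he1, he2⟩ := hK q' y hyK
    rw [hm, digitSum_add] at he1 he2
    have htail0 := digitSum_nonneg (fun i => (hw (q + i)).le) (fun i => e (q + i)) m
    have htail : digitSum (fun i => w (q + i)) (fun i => e (q + i)) m ≤ u q - u (q + m) :=
      digitSum_scale_le (by linarith) hu hua _ q m
    rw [Metric.mem_closedBall, Real.dist_eq, abs_le] at hyx
    rw [hm] at huq'
    refine ⟨digitSum w e q + digitSum (fun i => w (q + i)) (fun i => e (q + i)) m, ?_, ?_⟩
    · refine Finset.mem_coe.2 (Finset.mem_image₂_of_mem ?_ (digitSum_mem_digitSums _ _ _))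
      refine Finset.mem_filter.2 ⟨digitSum_mem_digitSums _ _ _, ?_, ?_⟩ <;> linarith
    · change edist _ _ ≤ _
      rw [edist_dist, ENNReal.ofReal_le_iff_le_toReal ENNReal.coe_ne_top, ENNReal.coe_toReal,
        Real.dist_eq, abs_le]
      constructor <;> linarith
  have hcard : (Finset.image₂ (· + ·) A B).card ≤ 6 * 2 ^ m :=
    (Finset.card_image₂_le _ _ _).trans (Nat.mul_le_mul hAcard (card_digitSums_le _ _))
  have hcov := hcover.externalCoveringNumber_le_encard
  rw [Set.encard_coe_eq_coe_finsetCard] at hcov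
  calc ((Metric.externalCoveringNumber r (Metric.closedBall x R ∩ K) : ℕ∞) : ℝ≥0∞)
      ≤ (((6 * 2 ^ m : ℕ) : ℕ∞) : ℝ≥0∞) := by
        exact_mod_cast hcov.trans (by exact_mod_cast hcard)
    _ = ENNReal.ofReal ((6 * 2 ^ m : ℕ) : ℝ) := by rw [ENNReal.ofReal_natCast]; simp
    _ ≤ _ := by
        refine ENNReal.ofReal_le_ofReal ?_
        push_cast
        linarith

/-- The lower bound for the Assouad dimension. If `K` contains, for arbitrarily large `p`, a scaled
copy of the set of `2 ^ p` left endpoints of the `p`-th stage of the central Cantor set with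
ratio `a`, then every admissible exponent is at least the dimension `t` of that Cantor set. -/
theorem le_of_isAssouadExponent {a t α : ℝ} {K : Set ℝ} (ha : 0 < a)
    (ha2 : a ≤ 1 / 2) (hat : (a⁻¹) ^ t = 2) (h0 : (0 : ℝ) ∈ K)
    (hK : ∀ N : ℕ, ∃ p ≥ N, ∃ R : ℝ, 0 < R ∧ R < 1 ∧
      ∀ e, digitSum (fun i => (1 - a) * (a ^ i * R)) e (p + 1) ∈ K)
    (hα : IsAssouadExponent K α) : t ≤ α := by
  obtain ⟨C, hC, hα⟩ := hα
  by_contra! hlt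
  -- the number of balls needed, `2 ^ p`, against the number allowed, `D * (a⁻¹ ^ α) ^ p`
  set D : ℝ := C * (4 / (1 - a)) ^ α with hD
  have hβ : (a⁻¹) ^ α < 2 := by
    rw [← hat]
    exact Real.rpow_lt_rpow_of_exponent_lt ((one_lt_inv₀ ha).2 (by linarith)) hlt
  have hβ0 : 0 < (a⁻¹) ^ α := by positivity
  have hev := (tendsto_pow_atTop_atTop_of_one_lt ((one_lt_div hβ0).2 hβ)).eventually_gt_atTop D
  obtain ⟨N, hN⟩ := eventually_atTop.1 hev
  obtain ⟨p, hp, R, hR0, hR1, hmem⟩ := hK N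
  have hlarge := hN p hp
  set w : ℕ → ℝ := fun i => (1 - a) * (a ^ i * R) with hw_def
  have h1a : 0 < 1 - a := by linarith
  have hw : ∀ i, 0 < w i := fun i => by simp only [hw_def]; positivity
  have hw2 : ∀ i, w (i + 1) ≤ w i / 2 := fun i => by
    have := mul_le_mul_of_nonneg_right ha2 (hw i).le
    simp only [hw_def] at this ⊢
    rw [pow_succ]
    linarith
  -- balls of this radius contain at most one of the points
  set r : ℝ := w p / 4 with hr_def
  have hr0 : 0 < r := by have := hw p; positivity
  have hrR : r ≤ R := by
    have h1 : a ^ p ≤ 1 := pow_le_one₀ ha.le (by linarith)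
    have h2 : a ^ p * R ≤ 1 * R := by gcongr
    have h3 : (1 - a) * (a ^ p * R) ≤ 1 * (1 * R) := by
      gcongr; linarith
    simp only [hr_def, hw_def]
    linarith
  have hsub : ((digitSums w (p + 1) : Finset ℝ) : Set ℝ) ⊆ Metric.closedBall 0 R ∩ K := by
    intro y hy
    obtain ⟨e, -, rfl⟩ := Finset.mem_image.1 (Finset.mem_coe.1 hy)
    refine ⟨?_, hmem _⟩
    have h1 := digitSum_nonneg (fun i => (hw i).le) (extendDigits e) (p + 1)
    have h2 := digitSum_scale_le (a := a) (u := fun i => a ^ i * R) (by linarith)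
      (fun i => by positivity) (fun i => by rw [pow_succ]; linarith) (extendDigits e) 0 (p + 1)
    have h3 : 0 < a ^ (0 + (p + 1)) * R := by positivity
    simp only [zero_add, pow_zero, one_mul] at h2 h3
    rw [Metric.mem_closedBall, Real.dist_eq, sub_zero, abs_of_nonneg h1]
    exact h2.trans (by linarith)
  have hsep : Metric.IsSeparated ((2 * r.toNNReal : ℝ≥0) : ℝ≥0∞)
      ((digitSums w (p + 1) : Finset ℝ) : Set ℝ) := by
    intro y hy z hz hyz
    have := le_abs_sub_of_mem_digitSums hw hw2 (Finset.mem_coe.1 hy) (Finset.mem_coe.1 hz) hyz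
    have h0 := hw p
    rw [edist_dist, Real.dist_eq, ENNReal.lt_ofReal_iff_toReal_lt ENNReal.coe_ne_top,
      ENNReal.coe_toReal]
    push_cast
    rw [Real.coe_toNNReal _ hr0.le]
    linarith
  have hnum := (hsep.encard_le_packingNumber hsub).trans
    (Metric.packingNumber_two_mul_le_externalCoveringNumber _ _)
  rw [Set.encard_coe_eq_coe_finsetCard, card_digitSums hw hw2] at hnum
  have hbound := hα r.toNNReal R.toNNReal (by simpa using hr0) (Real.toNNReal_le_toNNReal hrR)
    (by simpa using hR1) 0 h0
  rw [Real.coe_toNNReal _ hr0.le, Real.coe_toNNReal _ hR0.le] at hbound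
  have h2p : (2 : ℝ) ^ (p + 1) ≤ C * (R / r) ^ α := by
    have h1 : ((2 ^ (p + 1) : ℕ) : ℝ≥0∞) ≤ ENNReal.ofReal (C * (R / r) ^ α) := by
      refine le_trans ?_ hbound
      exact_mod_cast hnum
    rw [← ENNReal.ofReal_natCast, ENNReal.ofReal_le_ofReal_iff (by positivity)] at h1
    exact_mod_cast h1
  have hRr : R / r = 4 / (1 - a) * (a⁻¹) ^ p := by
    simp only [hr_def, hw_def, inv_pow]
    field_simp
  rw [hRr, Real.mul_rpow (by positivity) (by positivity), ← Real.rpow_natCast (a⁻¹),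
    ← Real.rpow_mul (by positivity), mul_comm (p : ℝ), Real.rpow_mul (by positivity),
    Real.rpow_natCast, ← mul_assoc, ← hD] at h2p
  rw [div_pow, lt_div_iff₀ (by positivity)] at hlarge
  have : (2 : ℝ) ^ p ≤ 2 ^ (p + 1) := pow_le_pow_right₀ (by norm_num) (by omega)
  linarith

/-! ### Blocks of binary digits and their scales -/

/-- The position of the first digit of the `n`-th block, when the blocks have lengths `p n`. -/
def blockStart (p : ℕ → ℕ) (n : ℕ) : ℕ := ∑ m ∈ Finset.range n, p m

/-- The index of the block that contains the position `q`. -/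
def blockIndex (p : ℕ → ℕ) (q : ℕ) : ℕ := Nat.findGreatest (fun n => blockStart p n ≤ q) q

/-- The diameter bound for the binary cylinders of length `q`. It drops by the factor `c ^ p n` at
the start of the `n`-th block, and by the factor `a` with every digit. -/
noncomputable def scale (p : ℕ → ℕ) (a c : ℝ) (q : ℕ) : ℝ :=
  (a * c) ^ blockStart p (blockIndex p q) *
    (c ^ p (blockIndex p q) * a ^ (q - blockStart p (blockIndex p q)))

theorem blockStart_succ (p : ℕ → ℕ) (n : ℕ) : blockStart p (n + 1) = blockStart p n + p n :=
  Finset.sum_range_succ _ _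

section Blocks

variable {p : ℕ → ℕ} (hp : ∀ n, 1 ≤ p n)
include hp

theorem blockStart_strictMono : StrictMono (blockStart p) :=
  strictMono_nat_of_lt_succ fun n => by
    have := hp n
    rw [blockStart_succ]; omega

theorem blockIndex_add (n : ℕ) {i : ℕ} (hi : i < p n) : blockIndex p (blockStart p n + i) = n := by
  have hle := (blockStart_strictMono hp).le_apply (x := n)
  refine Nat.findGreatest_eq_iff.2 ⟨by omega, fun _ => by omega, fun m hm _ => ?_⟩
  have := (blockStart_strictMono hp).monotone (Nat.succ_le_of_lt hm)
  rw [Nat.succ_eq_add_one, blockStart_succ] at this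
  omega

theorem exists_eq_blockStart_add (q : ℕ) : ∃ n i, i < p n ∧ q = blockStart p n + i := by
  have h0 : blockStart p 0 ≤ q := by simp [blockStart]
  have h1 : blockStart p (blockIndex p q) ≤ q :=
    Nat.findGreatest_spec (P := fun n => blockStart p n ≤ q) (Nat.zero_le q) h0
  refine ⟨blockIndex p q, q - blockStart p (blockIndex p q), ?_, by omega⟩
  by_contra! h
  have h2 : blockStart p (blockIndex p q + 1) ≤ q := by rw [blockStart_succ]; omega
  have h3 := Nat.le_findGreatest (P := fun n => blockStart p n ≤ q)
    ((blockStart_strictMono hp).le_apply.trans h2) h2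
  rw [← blockIndex] at h3
  omega

theorem scale_add (a c : ℝ) (n : ℕ) {i : ℕ} (hi : i < p n) :
    scale p a c (blockStart p n + i) = (a * c) ^ blockStart p n * (c ^ p n * a ^ i) := by
  rw [scale, blockIndex_add hp n hi, Nat.add_sub_cancel_left]

theorem pow_blockStart_succ (a c : ℝ) {n q : ℕ} (hq : q + 1 = blockStart p (n + 1)) :
    (a * c) ^ blockStart p (n + 1) = a * scale p a c q := by
  have hn := hp n
  obtain ⟨i, hi⟩ := Nat.exists_eq_add_of_le' hn
  have hsucc := blockStart_succ p n
  obtain rfl : q = blockStart p n + i := by omega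
  rw [scale_add hp a c n (by omega), hsucc, hi]
  ring

variable {a c : ℝ} (ha : 0 < a) (hc : 0 < c)
include ha hc

omit hp in
theorem scale_pos (q : ℕ) : 0 < scale p a c q := by
  unfold scale; positivity

theorem scale_blockStart_le (hc1 : c ≤ 1) (n : ℕ) :
    scale p a c (blockStart p n) ≤ (a * c) ^ blockStart p n := by
  have h := scale_add hp a c n (hp n)
  rw [add_zero, pow_zero, mul_one] at h
  rw [h]
  exact mul_le_of_le_one_right (by positivity) (pow_le_one₀ hc.le hc1)

theorem scale_succ_le (hc1 : c ≤ 1) (q : ℕ) : scale p a c (q + 1) ≤ a * scale p a c q := by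
  obtain ⟨n, i, hi, rfl⟩ := exists_eq_blockStart_add hp q
  by_cases hi' : i + 1 < p n
  · rw [add_assoc, scale_add hp a c n hi', scale_add hp a c n hi]
    exact le_of_eq (by ring)
  · have h : blockStart p n + i + 1 = blockStart p (n + 1) := by
      rw [blockStart_succ]; omega
    rw [← pow_blockStart_succ hp a c h, h]
    exact scale_blockStart_le hp ha hc hc1 _

end Blocks

/-! ### The iterated function system -/

/-- The maps of a level with `2 ^ l` maps send `[0, 1]` into itself: the translation parts are the
digit sums below, and the ratio is `(a * c) ^ l`. -/
theorem digitSum_level_le {a c : ℝ} (ha : 0 < a) (ha1 : a ≤ 1) (hc : 0 < c) (hc1 : c ≤ 1)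
    (e : ℕ → Bool) (l : ℕ) :
    digitSum (fun i => c ^ l * ((1 - a) * a ^ i)) e l + (a * c) ^ l ≤ 1 := by
  have h := digitSum_scale_le (u := fun i => a ^ i) ha1 (fun i => by positivity)
    (fun i => by rw [pow_succ, mul_comm]) e 0 l
  simp only [zero_add, pow_zero] at h
  rw [digitSum_const_mul, mul_pow, mul_comm (a ^ l), ← mul_add]
  have h1 : c ^ l ≤ 1 := pow_le_one₀ hc.le hc1
  have h2 : 0 < c ^ l := by positivity
  calc _ ≤ c ^ l * 1 := by gcongr; linarith
    _ ≤ 1 := by linarith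

/-- At level `n` there is one map for each binary string of length `p n`. All maps of the level have
ratio `(a * c) ^ p n`, and they send `[0, 1]` to the `p n`-th stage of the central Cantor
construction with ratio `a`, shrunk towards `0` by the factor `c ^ p n`. -/
noncomputable def clusterSystem {p : ℕ → ℕ} (hp : ∀ n, 1 ≤ p n) {a c : ℝ} (ha : 0 < a)
    (ha2 : a ≤ 1 / 2) (hc : 0 < c) (hc1 : c ≤ 1) : NonautonomousIFS ℝ where
  J n := Fin (p n) → Bool
  fintypeJ n := inferInstance
  two_le_card n := by
    simpa using Nat.pow_le_pow_right (n := 2) (by norm_num) (hp n)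
  ratio n _ := (a * c) ^ p n
  ratio_pos n _ := by positivity
  ratio_lt_one n _ :=
    pow_lt_one₀ (by positivity) (mul_lt_one_of_nonneg_of_lt_one_left ha.le (by linarith) hc1)
      (by have := hp n; omega)
  orth _ _ := LinearIsometryEquiv.refl ℝ ℝ
  trans n j := digitSum (fun i => c ^ p n * ((1 - a) * a ^ i)) (extendDigits j) (p n)
  X := Icc 0 1
  isCompact_X := isCompact_Icc
  nonempty_X := ⟨0, by simp⟩
  mapsTo_X n j x hx := by
    obtain ⟨hx0, hx1⟩ := hx
    have h1 := digitSum_level_le ha (by linarith) hc hc1 (extendDigits j) (p n)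
    have h2 : 0 < (a * c) ^ p n := by positivity
    have h3 := digitSum_nonneg (w := fun i => c ^ p n * ((1 - a) * a ^ i))
      (fun i => by have : 0 < 1 - a := by linarith
                   positivity) (extendDigits j) (p n)
    have h4 : (a * c) ^ p n * x ≤ (a * c) ^ p n := mul_le_of_le_one_right h2.le hx1
    have h5 : 0 ≤ (a * c) ^ p n * x := by positivity
    simp only [LinearIsometryEquiv.coe_refl, id_eq, smul_eq_mul, mem_Icc]
    constructor <;> linarith
  tendsto_ratio := by
    have hb : a * c < 1 := mul_lt_one_of_nonneg_of_lt_one_left ha.le (by linarith) hc1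
    have h : ∀ n : ℕ, (⨆ _ : (∀ i : Fin n, Fin (p i) → Bool), ∏ i : Fin n, (a * c) ^ p i) =
        (a * c) ^ blockStart p n := fun n => by
      rw [ciSup_const, Fin.prod_univ_eq_prod_range (fun i => (a * c) ^ p i),
        Finset.prod_pow_eq_pow_sum, blockStart]
    simp only [h]
    exact (tendsto_pow_atTop_nhds_zero_of_lt_one (by positivity) hb).comp
      (blockStart_strictMono hp).tendsto_atTop

section System

variable {p : ℕ → ℕ} (hp : ∀ n, 1 ≤ p n) {a c : ℝ} (ha : 0 < a) (ha2 : a ≤ 1 / 2) (hc : 0 < c)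
  (hc1 : c ≤ 1)

theorem clusterSystem_S (n : ℕ) (j : Fin (p n) → Bool) (x : ℝ) :
    (clusterSystem hp ha ha2 hc hc1).S n j x = (a * c) ^ p n * x +
      digitSum (fun i => c ^ p n * ((1 - a) * a ^ i)) (extendDigits j) (p n) := rfl

theorem openSetConditionWith_clusterSystem :
    (clusterSystem hp ha ha2 hc hc1).OpenSetConditionWith (Icc 0 1) := by
  refine ⟨isCompact_Icc, fun n j => ((clusterSystem hp ha ha2 hc hc1).mapsTo_X n j).image_subset,
    by simp, fun n (j : Fin (p n) → Bool) (j' : Fin (p n) → Bool) hjj => ?_⟩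
  rw [Set.disjoint_left]
  rintro _ ⟨x, hx, rfl⟩ ⟨y, hy, hxy⟩
  rw [interior_Icc] at hx hy
  rw [clusterSystem_S, clusterSystem_S] at hxy
  set v : ℕ → ℝ := fun i => c ^ p n * ((1 - a) * a ^ i) with hv_def
  have h1a : 0 < 1 - a := by linarith
  have hv : ∀ i, 0 < v i := fun i => by simp only [hv_def]; positivity
  have hv2 : ∀ i, v (i + 1) ≤ v i / 2 := fun i => by
    have := mul_le_mul_of_nonneg_right ha2 (hv i).le
    simp only [hv_def] at this ⊢
    rw [pow_succ]
    linarith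
  obtain ⟨l, hl⟩ := Nat.exists_eq_add_of_le' (hp n)
  obtain ⟨i, hi⟩ := Function.ne_iff.1 hjj
  have hsep := le_abs_digitSum_sub hv hv2 (extendDigits j) (extendDigits j') l
    ⟨i, by omega, by rwa [extendDigits_of_lt _ i.2, extendDigits_of_lt _ i.2]⟩
  rw [← hl] at hsep
  -- the distance of two left endpoints is at least the length of the intervals
  have hlen : (a * c) ^ p n ≤ v l := by
    have h1 : 0 < c ^ p n * a ^ l := by positivity
    have h2 := mul_le_mul_of_nonneg_left (by linarith : a ≤ 1 - a) h1.le
    calc (a * c) ^ p n = c ^ p n * a ^ l * a := by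
          rw [mul_pow, hl]; ring
      _ ≤ c ^ p n * a ^ l * (1 - a) := h2
      _ = v l := by simp only [hv_def]; ring
  have hb : 0 < (a * c) ^ p n := by positivity
  have h3 : digitSum v (extendDigits j) (p n) - digitSum v (extendDigits j') (p n) =
      (a * c) ^ p n * (y - x) := by linarith
  have h4 : |y - x| < 1 := by
    rw [abs_lt]; constructor <;> linarith [hx.1, hx.2, hy.1, hy.2]
  rw [h3, abs_mul, abs_of_pos hb] at hsep
  have h5 := mul_lt_mul_of_pos_left h4 hb
  linarith

include hp in
/-- The translations of level `n`, brought to their place in the compositions, are the digit sums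
of the `n`-th block. -/
theorem pow_mul_digitSum_level (n : ℕ) {e e' : ℕ → Bool} (he : ∀ i < p n, e i = e' i) :
    (a * c) ^ blockStart p n * digitSum (fun i => c ^ p n * ((1 - a) * a ^ i)) e (p n) =
      digitSum (fun i => (1 - a) * scale p a c (blockStart p n + i)) e' (p n) := by
  rw [← digitSum_const_mul]
  refine digitSum_congr (fun i hi => ?_) he
  rw [scale_add hp a c n hi]
  ring

theorem exists_digits_comp_eq (n : ℕ) (j : ∀ i : Fin n, Fin (p i) → Bool) :
    ∃ e, ∀ x, (clusterSystem hp ha ha2 hc hc1).comp n j x = (a * c) ^ blockStart p n * x +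
      digitSum (fun i => (1 - a) * scale p a c i) e (blockStart p n) := by
  induction n with
  | zero => exact ⟨fun _ => false, fun x => by simp [NonautonomousIFS.comp, blockStart, digitSum]⟩
  | succ n ih =>
    obtain ⟨e, he⟩ := ih fun i => j i.castSucc
    refine ⟨fun q => if q < blockStart p n then e q else
      extendDigits (j (Fin.last n)) (q - blockStart p n), fun x => ?_⟩
    rw [blockStart_succ, digitSum_add, pow_add]
    change (clusterSystem hp ha ha2 hc hc1).comp n (fun i => j i.castSucc)
      ((clusterSystem hp ha ha2 hc hc1).S n (j (Fin.last n)) x) = _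
    rw [he, clusterSystem_S, mul_add, ← mul_assoc, add_assoc]
    congr 1
    rw [add_comm]
    congr 1
    · exact digitSum_congr (fun _ _ => rfl) fun i hi => by simp [hi]
    · exact pow_mul_digitSum_level hp n fun i _ => by simp

theorem exists_comp_eq_digits (n : ℕ) (e : ℕ → Bool) :
    ∃ j : ∀ i : Fin n, Fin (p i) → Bool, ∀ x,
      (clusterSystem hp ha ha2 hc hc1).comp n j x = (a * c) ^ blockStart p n * x +
        digitSum (fun i => (1 - a) * scale p a c i) e (blockStart p n) := by
  refine ⟨fun i k => e (blockStart p i + k), ?_⟩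
  induction n with
  | zero => exact fun x => by simp [NonautonomousIFS.comp, blockStart, digitSum]
  | succ n ih =>
    intro x
    rw [blockStart_succ, digitSum_add, pow_add]
    change (clusterSystem hp ha ha2 hc hc1).comp n (fun i k => e (blockStart p i + k))
      ((clusterSystem hp ha ha2 hc hc1).S n (fun k => e (blockStart p n + k)) x) = _
    rw [ih, clusterSystem_S, mul_add, ← mul_assoc, add_assoc]
    congr 1
    rw [add_comm]
    congr 1
    exact pow_mul_digitSum_level hp n fun i hi => extendDigits_of_lt _ hi

/-- Every point of the limit set lies in a binary cylinder of each length. -/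
theorem exists_cylinder_of_mem_limitSet {y : ℝ}
    (hy : y ∈ (clusterSystem hp ha ha2 hc hc1).limitSet) (q : ℕ) :
    ∃ e, digitSum (fun i => (1 - a) * scale p a c i) e q ≤ y ∧
      y ≤ digitSum (fun i => (1 - a) * scale p a c i) e q + scale p a c q := by
  obtain ⟨j, x, ⟨hx0, hx1⟩, rfl⟩ := mem_iUnion.1 (mem_iInter.1 hy q)
  obtain ⟨e, he⟩ := exists_digits_comp_eq hp ha ha2 hc hc1 (q + 1) j
  refine ⟨e, ?_⟩
  have hlt : q + 1 ≤ blockStart p (q + 1) := (blockStart_strictMono hp).le_apply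
  obtain ⟨m, hm⟩ := Nat.exists_eq_add_of_le hlt
  have hm' : q + m + 1 = blockStart p (q + 1) := by omega
  have hpow := pow_blockStart_succ hp a c hm'
  have hpos := scale_pos (p := p) ha hc (q + m)
  have h1a : 0 < 1 - a := by linarith
  rw [he, hpow, ← hm', add_assoc q, digitSum_add, digitSum_succ]
  have htail := digitSum_scale_le (by linarith) (scale_pos (p := p) ha hc)
    (scale_succ_le hp ha hc hc1) (fun i => e (q + i)) q m
  have htail0 := digitSum_nonneg (w := fun i => (1 - a) * scale p a c (q + i))
    (fun i => mul_nonneg h1a.le (scale_pos ha hc _).le) (fun i => e (q + i)) m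
  have hx2 : 0 ≤ a * scale p a c (q + m) * x := by positivity
  have hx3 : a * scale p a c (q + m) * x ≤ a * scale p a c (q + m) :=
    mul_le_of_le_one_right (by positivity) hx1
  have hlast : 0 ≤ (1 - a) * scale p a c (q + m) := by positivity
  constructor <;> split_ifs <;> linarith

/-- Finite digit expansions belong to the limit set. -/
theorem digitSum_mem_limitSet {e : ℕ → Bool} {l : ℕ} (he : ∀ i, l ≤ i → e i = false) :
    digitSum (fun i => (1 - a) * scale p a c i) e l ∈
      (clusterSystem hp ha ha2 hc hc1).limitSet := by
  refine mem_iInter.2 fun n => mem_iUnion.2 ?_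
  obtain ⟨j, hj⟩ := exists_comp_eq_digits hp ha ha2 hc hc1 (n + 1) e
  set w : ℕ → ℝ := fun i => (1 - a) * scale p a c i
  set Q := blockStart p (n + 1)
  have hb : 0 < (a * c) ^ Q := by positivity
  have h1a : 0 < 1 - a := by linarith
  have htail : digitSum (fun i => w (Q + i)) (fun i => e (Q + i)) l ≤
      scale p a c Q - scale p a c (Q + l) :=
    digitSum_scale_le (by linarith) (scale_pos (p := p) ha hc)
      (scale_succ_le hp ha hc hc1) (fun i => e (Q + i)) Q l
  have htail0 := digitSum_nonneg (w := fun i => w (Q + i))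
    (fun i => mul_nonneg h1a.le (scale_pos ha hc _).le) (fun i => e (Q + i)) l
  have hQ : scale p a c Q ≤ (a * c) ^ Q := scale_blockStart_le hp ha hc hc1 (n + 1)
  have hpos := scale_pos (p := p) ha hc (Q + l)
  refine ⟨j, digitSum (fun i => w (Q + i)) (fun i => e (Q + i)) l / (a * c) ^ Q,
    ⟨by positivity, (div_le_one hb).2 (by linarith)⟩, ?_⟩
  rw [hj, mul_div_cancel₀ _ hb.ne', add_comm, ← digitSum_add, add_comm Q, digitSum_add]
  simp [digitSum, he]

theorem assouadDim_clusterSystem {t : ℝ} (ht : 0 < t) (hat : (a⁻¹) ^ t = 2)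
    (hunb : ∀ N, ∃ n ≥ 1, N < p n) :
    assouadDim (clusterSystem hp ha ha2 hc hc1).limitSet = (t : EReal) := by
  refine le_antisymm (iInf₂_le t ?_) (le_iInf₂ fun α hα => EReal.coe_le_coe_iff.2 ?_)
  · exact isAssouadExponent_of_cylinders ha ha2 ht hat (scale_pos (p := p) ha hc)
      (scale_succ_le hp ha hc hc1)
      fun q y hy => exists_cylinder_of_mem_limitSet hp ha ha2 hc hc1 hy q
  refine le_of_isAssouadExponent ha ha2 hat ?_ (fun N => ?_) hα
  · simpa [digitSum] using digitSum_mem_limitSet hp ha ha2 hc hc1 (e := fun _ => false) (l := 0)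
      fun _ _ => rfl
  obtain ⟨n, hn1, hn⟩ := hunb N
  obtain ⟨m, hm⟩ := Nat.exists_eq_add_of_le' (hp n)
  have hb : a * c < 1 := mul_lt_one_of_nonneg_of_lt_one_left ha.le (by linarith) hc1
  have hstart : n ≤ blockStart p n := (blockStart_strictMono hp).le_apply
  refine ⟨m, by omega, scale p a c (blockStart p n), scale_pos ha hc _,
    (scale_blockStart_le hp ha hc hc1 n).trans_lt
      (pow_lt_one₀ (by positivity) hb (by omega)), fun e => ?_⟩
  -- the digits `e` are put into the `n`-th block, and all other digits are `0`
  have hmem := digitSum_mem_limitSet hp ha ha2 hc hc1 (l := blockStart p n + p n)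
    (e := fun q => decide (blockStart p n ≤ q ∧ q < blockStart p n + p n) &&
      e (q - blockStart p n)) fun i hi => by simp [hi.not_gt]
  have hzero : digitSum (fun i => (1 - a) * scale p a c i)
      (fun q => decide (blockStart p n ≤ q ∧ q < blockStart p n + p n) &&
        e (q - blockStart p n)) (blockStart p n) = 0 :=
    Finset.sum_eq_zero fun i hi => by simp [(Finset.mem_range.1 hi).not_ge]
  rw [digitSum_add, hzero, zero_add] at hmem
  convert hmem using 1
  rw [← hm]
  refine digitSum_congr (fun i hi => ?_) fun i hi => by simp [hi]
  have h0 := scale_add hp a c n (hp n)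
  rw [add_zero, pow_zero, mul_one] at h0
  rw [h0, scale_add hp a c n hi]
  ring

theorem isTheta_clusterSystem {s : ℝ} (has : ((a * c)⁻¹) ^ s = 2) (n m : ℕ)
    (hm : 1 ≤ m) : (clusterSystem hp ha ha2 hc hc1).IsTheta n m s := by
  intro t
  have hb : 0 < a * c := by positivity
  have hb1 : a * c < 1 := mul_lt_one_of_nonneg_of_lt_one_left ha.le (by linarith) hc1
  have hlogb : Real.log (a * c) < 0 := Real.log_neg hb hb1
  have hlog2 : Real.log 2 = -s * Real.log (a * c) := by
    rw [← has, Real.log_rpow (by positivity), Real.log_inv]; ring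
  have hsum : (∑ _j : (∀ k : Fin m, Fin (p (n + k)) → Bool), ∏ k : Fin m, ((a * c) ^ p (n + k)) ^ t)
      = (2 * (a * c) ^ t) ^ (∑ k : Fin m, p (n + k)) := by
    rw [Finset.sum_const, Finset.card_univ, Fintype.card_pi, nsmul_eq_mul, Nat.cast_prod,
      ← Finset.prod_mul_distrib, ← Finset.prod_pow_eq_pow_sum]
    refine Finset.prod_congr rfl fun k _ => ?_
    have hswap : ((a * c) ^ p (n + k)) ^ t = ((a * c) ^ t) ^ p (n + k) := by
      rw [← Real.rpow_natCast, ← Real.rpow_natCast, ← Real.rpow_mul hb.le, ← Real.rpow_mul hb.le,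
        mul_comm t]
    rw [hswap, mul_pow]
    simp
  have hpress : (clusterSystem hp ha ha2 hc hc1).pressure n m t =
      1 / (m : ℝ) * ((∑ k : Fin m, p (n + k) : ℕ) * ((t - s) * Real.log (a * c))) := by
    change 1 / (m : ℝ) * Real.log (∑ _j : (∀ k : Fin m, Fin (p (n + k)) → Bool),
      ∏ k : Fin m, ((a * c) ^ p (n + k)) ^ t) = _
    rw [hsum, Real.log_pow, Real.log_mul (by norm_num) (by positivity), Real.log_rpow hb, hlog2]
    ring
  have hne : (∑ k : Fin m, p (n + k)) ≠ 0 := by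
    have : p (n + (⟨0, hm⟩ : Fin m)) ≤ ∑ k : Fin m, p (n + k) :=
      Finset.single_le_sum (f := fun k : Fin m => p (n + k)) (fun _ _ => Nat.zero_le _)
        (Finset.mem_univ _)
    have := hp (n + (⟨0, hm⟩ : Fin m))
    omega
  have hm0 : (m : ℝ) ≠ 0 := by positivity
  have hne' : ((∑ k : Fin m, p (n + k) : ℕ) : ℝ) ≠ 0 := Nat.cast_ne_zero.2 hne
  rw [hpress]
  simp only [mul_eq_zero, div_eq_zero_iff, one_ne_zero, hm0, hne', hlogb.ne, sub_eq_zero,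
    false_or, or_false]

end System

/-! ### The cone condition and the choice of the parameters -/

theorem coneCondition_Icc : ConeCondition (Icc (0 : ℝ) 1) := by
  refine ⟨1 / 2, by norm_num, fun x hx r hr0 hr1 => ?_⟩
  rw [interior_Icc, Module.finrank_self, pow_one]
  -- one of the two halves of the ball contains an interval of length `r / 2` inside `(0, 1)`
  obtain ⟨z, hz⟩ : ∃ z, Ioo z (z + 1 / 2 * r) ⊆ Metric.closedBall x r ∩ Ioo 0 1 := by
    rcases le_total x (1 / 2) with h | h
    · refine ⟨x, fun y hy => ⟨?_, ?_, ?_⟩⟩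
      · rw [Metric.mem_closedBall, Real.dist_eq, abs_le]
        constructor <;> linarith [hy.1, hy.2]
      · linarith [hy.1, hx.1]
      · linarith [hy.2]
    · refine ⟨x - 1 / 2 * r, fun y hy => ⟨?_, ?_, ?_⟩⟩
      · rw [Metric.mem_closedBall, Real.dist_eq, abs_le]
        constructor <;> linarith [hy.1, hy.2]
      · linarith [hy.1]
      · linarith [hy.2, hx.2]
  calc ENNReal.ofReal (1 / 2 * r) = volume (Ioo z (z + 1 / 2 * r)) := by
        rw [Real.volume_Ioo, add_sub_cancel_left]
    _ ≤ _ := measure_mono hz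

theorem inv_two_rpow_inv_rpow {s : ℝ} (hs : 0 < s) : (((2 : ℝ) ^ (-s⁻¹))⁻¹) ^ s = 2 := by
  rw [← Real.rpow_neg (by norm_num), neg_neg, ← Real.rpow_mul (by norm_num),
    inv_mul_cancel₀ hs.ne', Real.rpow_one]

theorem mainTheorem10 (k : ℕ → ℝ) (hk2 : ∀ n, 2 ≤ k n)
    (hk : Filter.limsup (fun n => (k n : EReal)) Filter.atTop = ⊤)
    (s t : ℝ) (hs : 0 < s) (hst : s ≤ t) (ht : t ≤ 1) :
    ∃ Φ : NonautonomousIFS ℝ,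
      Φ.X = Set.Icc 0 1 ∧
      Φ.IsHomogeneous ∧
      Φ.OpenSetConditionWith (Set.Icc 0 1) ∧
      ConeCondition (Set.Icc (0 : ℝ) 1) ∧
      (∀ n, (Fintype.card (Φ.J n) : ℝ) ≤ k n) ∧
      assouadDim Φ.limitSet = (t : EReal) ∧
      (∀ n m : ℕ, 1 ≤ m → Φ.IsTheta n m s) := by
  have ht0 : 0 < t := hs.trans_le hst
  have hinv : t⁻¹ ≤ s⁻¹ := inv_anti₀ hs hst
  have hinv1 : 1 ≤ t⁻¹ := (one_le_inv₀ ht0).2 ht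
  set p : ℕ → ℕ := fun n => Nat.log 2 ⌊k n⌋₊ with hp_def
  have hfloor : ∀ n, 2 ≤ ⌊k n⌋₊ := fun n => Nat.le_floor (by exact_mod_cast hk2 n)
  have hp : ∀ n, 1 ≤ p n := fun n => Nat.log_pos (by norm_num) (hfloor n)
  have hunb : ∀ N, ∃ n ≥ 1, N < p n := fun N => by
    have hlt : (((2 ^ (N + 1) : ℕ) : ℝ) : EReal) <
        Filter.limsup (fun n => (k n : EReal)) Filter.atTop := by
      rw [hk]; exact EReal.coe_lt_top _
    obtain ⟨n, hn, hn1⟩ :=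
      ((Filter.frequently_lt_of_lt_limsup (by isBoundedDefault) hlt).and_eventually
        (eventually_ge_atTop 1)).exists
    refine ⟨n, hn1, Nat.lt_of_succ_le (Nat.le_log_of_pow_le (by norm_num) (Nat.le_floor ?_))⟩
    exact (EReal.coe_lt_coe_iff.1 hn).le
  -- `a` is the ratio of a Cantor set of dimension `t`, and `a * c` that of one of dimension `s`
  set a : ℝ := 2 ^ (-t⁻¹) with ha_def
  set c : ℝ := 2 ^ (t⁻¹ - s⁻¹) with hc_def
  have ha : 0 < a := by positivity
  have hc : 0 < c := by positivity
  have ha2 : a ≤ 1 / 2 := by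
    calc a ≤ 2 ^ (-1 : ℝ) := Real.rpow_le_rpow_of_exponent_le (by norm_num) (by linarith)
      _ = 1 / 2 := by rw [Real.rpow_neg_one]; norm_num
  have hc1 : c ≤ 1 := Real.rpow_le_one_of_one_le_of_nonpos (by norm_num) (by linarith)
  have hac : a * c = 2 ^ (-s⁻¹) := by
    rw [ha_def, hc_def, ← Real.rpow_add (by norm_num)]
    congr 1
    ring
  refine ⟨clusterSystem hp ha ha2 hc hc1, rfl, fun n => ⟨(a * c) ^ p n, fun _ => rfl⟩,
    openSetConditionWith_clusterSystem hp ha ha2 hc hc1, coneCondition_Icc, fun n => ?_,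
    assouadDim_clusterSystem hp ha ha2 hc hc1 ht0 (inv_two_rpow_inv_rpow ht0) hunb,
    isTheta_clusterSystem hp ha ha2 hc hc1 (by rw [hac]; exact inv_two_rpow_inv_rpow hs)⟩
  change (Fintype.card (Fin (p n) → Bool) : ℝ) ≤ k n
  have h1 : 2 ^ p n ≤ ⌊k n⌋₊ := Nat.pow_log_le_self 2 (by have := hfloor n; omega)
  have h2 : (⌊k n⌋₊ : ℝ) ≤ k n := Nat.floor_le (by linarith [hk2 n])
  calc (Fintype.card (Fin (p n) → Bool) : ℝ) = ((2 ^ p n : ℕ) : ℝ) := by simp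
    _ ≤ ⌊k n⌋₊ := by exact_mod_cast h1
    _ ≤ k n := h2
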